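/- For a measurable function $f:[0,1]\to\mathbb{C}$ let $f^*(t)=\inf\{s\ge 0: |\{x\in[0,1]:|f(x)|>s\}|\le t\}$ be the non-increasing rearrangement of $|f|$, and for a family $c=(c_n)_{n\in I}$ of complex numbers let $c_k^*=\inf\{s\ge 0:\#\{n\in I:|c_n|>s\}<k\}$ $(k=1,2,\dots)$ be the non-increasing rearrangement of $(|c_n|)$. For $\beta\in\mathbb{R}$ let $L_{2,2}(\log L)_\beta$ be the set of measurable $f:[0,1]\to\mathbb{C}$ (functions that agree almost everywhere being identified) with $$\|f\|_{L_{2,2}(\log L)_\beta}:=\Big(\int_0^1\big[(1+|\log t|)^{\beta}f^*(t)\big]^2\,dt\Big)^{1/2}<\infty,$$ and let $l_{2,2}(\log l)_\beta$ be the set of bounded families $c$ with $$\|c\|_{l_{2,2}(\log l)_\beta}:=\Big(\sum_{k=1}^\infty\big[(1+\log k)^{\beta}c_k^*\big]^2\Big)^{1/2}<\infty.$$ Let $\alpha<-1/2$. Then there is a constant $C>0$, depending only on $\alpha$, such that the following holds. Let $I$ be a non-empty, at most countable index set (for example $\mathbb{N}$ or $\mathbb{Z}$), let $(\varphi_n)_{n\in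 I}$ be an orthonormal system in $L_2([0,1])$ with $M:=\sup_{n\in I}\|\varphi_n\|_{L_\infty}<\infty$, and let $f\in L_{2,2}(\log L)_{\alpha+1/2}$. Then every function $f\,\overline{\varphi_n}$ is integrable on $[0,1]$, the family $\mathcal{F}(f)=(c_n(f))_{n\in I}$ of Fourier coefficients $c_n(f)=\int_0^1 f(x)\overline{\varphi_n(x)}\,dx$ belongs to $l_{2,2}(\log l)_{\alpha+1/2}$, and $$\|\mathcal{F}(f)\|_{l_{2,2}(\log l)_{\alpha+1/2}}\le C\,\min\big(M,(1+\log M)^{|\alpha|}\big)\,\|f\|_{L_{2,2}(\log L)_{\alpha+1/2}}.$$ -/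

import Mathlib

open MeasureTheory Set
open scoped ENNReal ComplexConjugate

noncomputable section

/-- Lebesgue measure on the unit interval `[0, 1]`. -/
abbrev unitMeasure : Measure ℝ := volume.restrict (Icc (0 : ℝ) 1)

/-- The non-increasing rearrangement of `|f|` for a function `f` on `[0, 1]`:
`f^*(t) = inf {s ≥ 0 : |{x ∈ [0, 1] : |f x| > s}| ≤ t}`. -/
def rearrangement (f : ℝ → ℂ) (t : ℝ) : ℝ≥0∞ :=
  sInf {s : ℝ≥0∞ | unitMeasure {x | s < ‖f x‖ₑ} ≤ ENNReal.ofReal t}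

/-- The non-increasing rearrangement `c_1^* ≥ c_2^* ≥ …` of the family `|c n|`:
`c_k^* = inf {s ≥ 0 : #{n : |c n| > s} < k}` for `k ≥ 1`.
For `k = 1` it is the supremum of the family. -/
def seqRearrangement {ι : Type*} (c : ι → ℂ) (k : ℕ) : ℝ≥0∞ :=
  sInf {s : ℝ≥0∞ | {n | s < ‖c n‖ₑ}.encard < (k : ℕ∞)}

/-- The quasi-norm `‖ t^{1/p - 1/q} (1 + |log t|)^a f^*(t) | L_q(0, 1) ‖` of the Lorentz–Zygmund
space `L_{p,q}(log L)_a`, where `1/∞ = 0`. -/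
def lorentzZygmundNorm (p q : ℝ≥0∞) (a : ℝ) (f : ℝ → ℂ) : ℝ≥0∞ :=
  eLpNorm (fun t : ℝ =>
      ENNReal.ofReal (t ^ (p.toReal⁻¹ - q.toReal⁻¹) * (1 + |Real.log t|) ^ a) * rearrangement f t)
    q (volume.restrict (Ioo (0 : ℝ) 1))

/-- Membership in the Lorentz–Zygmund space `L_{p,q}(log L)_a` on `[0, 1]`. -/
def MemLorentzZygmund (p q : ℝ≥0∞) (a : ℝ) (f : ℝ → ℂ) : Prop :=
  AEStronglyMeasurable f unitMeasure ∧ lorentzZygmundNorm p q a f < ∞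

/-- The quasi-norm `‖ k^{1/p - 1/q} (1 + log k)^a c_k^* | l_q ‖` (`k = 1, 2, …`) of the
Lorentz–Zygmund sequence space `l_{p,q}(log l)_a`. The summation index is `j = k - 1`. -/
def seqLorentzZygmundNorm {ι : Type*} (p q : ℝ≥0∞) (a : ℝ) (c : ι → ℂ) : ℝ≥0∞ :=
  eLpNorm (fun j : ℕ =>
      ENNReal.ofReal (((j + 1 : ℕ) : ℝ) ^ (p.toReal⁻¹ - q.toReal⁻¹) *
        (1 + Real.log ((j + 1 : ℕ) : ℝ)) ^ a) * seqRearrangement c (j + 1))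
    q Measure.count

/-- Membership in the Lorentz–Zygmund sequence space `l_{p,q}(log l)_a` of bounded families. -/
def MemSeqLorentzZygmund {ι : Type*} (p q : ℝ≥0∞) (a : ℝ) (c : ι → ℂ) : Prop :=
  (∃ B : ℝ, ∀ n, ‖c n‖ ≤ B) ∧ seqLorentzZygmundNorm p q a c < ∞

/-- The Fourier series map: `c_n(f) = ∫_0^1 f(x) conj(φ_n(x)) dx`. -/
def fourierMap {ι : Type*} (φ : ι → Lp ℂ 2 unitMeasure) (f : ℝ → ℂ) (n : ι) : ℂ :=
  ∫ x, f x * conj (φ n x) ∂unitMeasure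

end

/-!
Cut `f` at the level `f^*(t)`, `t = 1 / (M² n)`. Bessel's inequality for the low part and the bound
`|c_k(h)| ≤ M ‖h‖₁` for the high part give
`∑_{k ≤ n} (c_k^*)² ≤ 10 ∫ min (1, √(M² n u)) f^*(u)² du`.
The right-hand side telescopes as a sum over `k < n`, so Hardy's lemma (summation by parts) allows
one to insert the decreasing weights `(1 + log k)^{-g}`, where `g = -2 (α + 1 / 2)`. What remains is
pointwise in `u`: with `x_k = min (1, √(M² k u))` one has `x_k² ≤ M² k u`, hence
`(1 + log k)^{-g} ≤ C (1 + log M²)^g (1 + |log u|)^{-g} x_k^{-1/2}`,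
and `∑ (x_{k+1} - x_k) x_{k+1}^{-1/2} ≤ 2` by comparison with the increments of `2 √x_k`.
-/

section Majorization

theorem sum_range_mul_le_of_sum_range_le {w a b : ℕ → ℝ≥0∞} (hw : Antitone w)
    (h : ∀ n, ∑ k ∈ Finset.range n, a k ≤ ∑ k ∈ Finset.range n, b k) (n : ℕ) :
    ∑ k ∈ Finset.range n, w k * a k ≤ ∑ k ∈ Finset.range n, w k * b k := by
  induction n generalizing w with
  | zero => simp
  | succ n ih =>
    have split_weight (c : ℕ → ℝ≥0∞) : ∑ k ∈ Finset.range (n + 1), w k * c k =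
        ∑ k ∈ Finset.range n, (w k - w n) * c k + w n * ∑ k ∈ Finset.range (n + 1), c k := by
      rw [Finset.sum_range_succ, Finset.sum_range_succ, mul_add, ← add_assoc, Finset.mul_sum,
        ← Finset.sum_add_distrib]
      congr 1
      refine Finset.sum_congr rfl fun k hk => ?_
      rw [← add_mul, tsub_add_cancel_of_le (hw (Finset.mem_range.1 hk).le)]
    rw [split_weight a, split_weight b]
    exact add_le_add (ih fun i j hij => tsub_le_tsub_right (hw hij) _)
      (mul_le_mul_right (h (n + 1)) _)

theorem tsum_mul_le_of_sum_range_le {w a b : ℕ → ℝ≥0∞} (hw : Antitone w)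
    (h : ∀ n, ∑ k ∈ Finset.range n, a k ≤ ∑ k ∈ Finset.range n, b k) :
    ∑' k, w k * a k ≤ ∑' k, w k * b k :=
  ENNReal.tsum_le_of_sum_range_le fun n =>
    (sum_range_mul_le_of_sum_range_le hw h n).trans (ENNReal.sum_le_tsum _)

theorem sum_range_inv_sqrt_mul_sub_le {x : ℕ → ℝ} (hx : Monotone x) (hx0 : 0 ≤ x 0) (n : ℕ) :
    ∑ k ∈ Finset.range n, (√(x (k + 1)))⁻¹ * (x (k + 1) - x k) ≤ 2 * √(x n) := by
  have hterm (k : ℕ) :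
      (√(x (k + 1)))⁻¹ * (x (k + 1) - x k) ≤ 2 * (√(x (k + 1)) - √(x k)) := by
    have hk : 0 ≤ x k := hx0.trans (hx k.zero_le)
    have hle : √(x k) ≤ √(x (k + 1)) := Real.sqrt_le_sqrt (hx k.le_succ)
    obtain hzero | hpos := (Real.sqrt_nonneg (x (k + 1))).eq_or_lt
    · simp [← hzero, le_antisymm (hle.trans hzero.ge) (Real.sqrt_nonneg _)]
    rw [inv_mul_le_iff₀ hpos]
    nlinarith [Real.sq_sqrt hk, Real.sq_sqrt (hk.trans (hx k.le_succ))]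
  calc _ ≤ ∑ k ∈ Finset.range n, 2 * (√(x (k + 1)) - √(x k)) :=
        Finset.sum_le_sum fun k _ => hterm k
    _ = 2 * (√(x n) - √(x 0)) := by
        rw [← Finset.mul_sum, Finset.sum_range_sub fun k => √(x k)]
    _ ≤ _ := by linarith [Real.sqrt_nonneg (x 0)]

end Majorization

section LogWeights

/-- The damping factor `min (1, √y)`, which at `y = u / t` weighs the part of a rearrangement on
`(0, t)` by `√(u / t)` and leaves the part on `(t, 1)` unchanged. -/
noncomputable def ramp (y : ℝ) : ℝ := min 1 √y

theorem ramp_zero : ramp 0 = 0 := by simp [ramp]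

theorem ramp_nonneg (y : ℝ) : 0 ≤ ramp y := le_min zero_le_one (Real.sqrt_nonneg y)

theorem ramp_le_one (y : ℝ) : ramp y ≤ 1 := min_le_left _ _

theorem ramp_pos {y : ℝ} (hy : 0 < y) : 0 < ramp y := lt_min one_pos (Real.sqrt_pos.2 hy)

theorem ramp_mono : Monotone ramp := fun _ _ h => min_le_min_left _ (Real.sqrt_le_sqrt h)

theorem measurable_ramp : Measurable ramp := ramp_mono.measurable

theorem ramp_eq_sqrt {y : ℝ} (hy : y ≤ 1) : ramp y = √y :=
  min_eq_right (Real.sqrt_le_one.2 hy)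

theorem ramp_eq_one {y : ℝ} (hy : 1 ≤ y) : ramp y = 1 :=
  min_eq_left (Real.one_le_sqrt.2 hy)

theorem ramp_sq_le {y : ℝ} (hy : 0 ≤ y) : ramp y ^ 2 ≤ y :=
  (pow_le_pow_left₀ (ramp_nonneg y) (min_le_right _ _) 2).trans_eq (Real.sq_sqrt hy)

theorem one_add_log_rpow_le {g ε z : ℝ} (hg : 0 < g) (hε : 0 < ε) (hz : 1 ≤ z) :
    (1 + Real.log z) ^ g ≤ (1 + g / ε) ^ g * z ^ ε := by
  have hz0 : 0 ≤ z := zero_le_one.trans hz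
  have hlog : 1 + Real.log z ≤ (1 + g / ε) * z ^ (ε / g) := by
    have hone : 1 ≤ z ^ (ε / g) := Real.one_le_rpow hz (by positivity)
    have hdiv := Real.log_le_rpow_div hz0 (div_pos hε hg)
    rw [div_div_eq_mul_div, mul_div_assoc, mul_comm] at hdiv
    linarith
  calc (1 + Real.log z) ^ g ≤ ((1 + g / ε) * z ^ (ε / g)) ^ g :=
        Real.rpow_le_rpow (by linarith [Real.log_nonneg hz]) hlog hg.le
    _ = (1 + g / ε) ^ g * z ^ ε := by
        rw [Real.mul_rpow (by positivity) (by positivity), ← Real.rpow_mul hz0,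
          div_mul_cancel₀ _ hg.ne']

theorem one_add_log_rpow_le_mul_min {a b M : ℝ} (ha : 0 < a) (hab : a ≤ b) (hM : 1 ≤ M) :
    (1 + Real.log M) ^ a ≤ (1 + a) ^ a * min M ((1 + Real.log M) ^ b) := by
  have hlog : 1 ≤ 1 + Real.log M := by linarith [Real.log_nonneg hM]
  rw [mul_min_of_nonneg _ _ (by positivity)]
  refine le_min (by simpa using one_add_log_rpow_le ha one_pos hM) ?_
  exact (Real.rpow_le_rpow_of_exponent_le hlog hab).trans
    (le_mul_of_one_le_left (by positivity) (Real.one_le_rpow (by linarith) ha.le))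

theorem one_add_abs_log_le {N K u : ℝ} (hN : 1 ≤ N) (hK : 1 ≤ K) (hu0 : 0 < u) (hu1 : u ≤ 1) :
    1 + |Real.log u| ≤
      2 * (1 + Real.log N) * (1 + Real.log K) * (1 + Real.log (ramp (N * K * u))⁻¹) := by
  have hpos : 0 < N * K * u := by positivity
  have hlog : 2 * Real.log (ramp (N * K * u)) ≤ Real.log N + Real.log K + Real.log u := by
    rw [← Real.log_mul (by positivity) (by positivity),
      ← Real.log_mul (by positivity) hu0.ne', ← Nat.cast_ofNat (R := ℝ), ← Real.log_pow]
    exact Real.log_le_log (pow_pos (ramp_pos hpos) 2) (ramp_sq_le hpos.le)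
  have hr : Real.log (ramp (N * K * u)) ≤ 0 := Real.log_nonpos (ramp_nonneg _) (ramp_le_one _)
  have hN' := Real.log_nonneg hN
  have hK' := Real.log_nonneg hK
  rw [abs_of_nonpos (Real.log_nonpos hu0.le hu1), Real.log_inv]
  nlinarith [mul_nonneg hN' hK', mul_nonneg (add_nonneg hN' hK') (neg_nonneg.2 hr),
    mul_nonneg (mul_nonneg hN' hK') (neg_nonneg.2 hr)]

theorem one_add_log_rpow_neg_le {g N K u : ℝ} (hg : 0 < g) (hN : 1 ≤ N) (hK : 1 ≤ K)
    (hu0 : 0 < u) (hu1 : u ≤ 1) :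
    (1 + Real.log K) ^ (-g) ≤ (2 * (1 + 2 * g)) ^ g * (1 + Real.log N) ^ g *
      (1 + |Real.log u|) ^ (-g) * (√(ramp (N * K * u)))⁻¹ := by
  set x := ramp (N * K * u)
  have hx0 : 0 < x := ramp_pos (by positivity)
  have hx1 : 1 ≤ x⁻¹ := (one_le_inv₀ hx0).2 (ramp_le_one _)
  have hN' : 0 < 1 + Real.log N := by linarith [Real.log_nonneg hN]
  have hK' : 0 < 1 + Real.log K := by linarith [Real.log_nonneg hK]
  have hx' : 0 < 1 + Real.log x⁻¹ := by linarith [Real.log_nonneg hx1]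
  have hL : 0 < 1 + |Real.log u| := by positivity
  have hratio : (1 + Real.log K)⁻¹ ≤
      2 * (1 + Real.log N) * (1 + |Real.log u|)⁻¹ * (1 + Real.log x⁻¹) := by
    rw [inv_le_iff_one_le_mul₀ hK']
    calc 1 = (1 + |Real.log u|)⁻¹ * (1 + |Real.log u|) := (inv_mul_cancel₀ hL.ne').symm
      _ ≤ (1 + |Real.log u|)⁻¹ *
            (2 * (1 + Real.log N) * (1 + Real.log K) * (1 + Real.log x⁻¹)) := by
          gcongr
          exact one_add_abs_log_le hN hK hu0 hu1
      _ = _ := by ring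
  calc (1 + Real.log K) ^ (-g) = ((1 + Real.log K)⁻¹) ^ g := by
        rw [Real.inv_rpow hK'.le, Real.rpow_neg hK'.le]
    _ ≤ (2 * (1 + Real.log N) * (1 + |Real.log u|)⁻¹ * (1 + Real.log x⁻¹)) ^ g :=
        Real.rpow_le_rpow (by positivity) hratio hg.le
    _ = 2 ^ g * (1 + Real.log N) ^ g * (1 + |Real.log u|) ^ (-g) * (1 + Real.log x⁻¹) ^ g := by
        rw [Real.mul_rpow (by positivity) hx'.le, Real.mul_rpow (by positivity) (by positivity),
          Real.mul_rpow (by positivity) hN'.le, Real.inv_rpow hL.le, Real.rpow_neg hL.le]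
    _ ≤ 2 ^ g * (1 + Real.log N) ^ g * (1 + |Real.log u|) ^ (-g) *
          ((1 + g / (1 / 2)) ^ g * x⁻¹ ^ (1 / 2 : ℝ)) := by
        gcongr
        exact one_add_log_rpow_le hg one_half_pos hx1
    _ = _ := by
        rw [← Real.sqrt_eq_rpow, Real.sqrt_inv, Real.mul_rpow zero_le_two (by positivity),
          div_div_eq_mul_div, div_one, mul_comm g]
        ring

theorem antitone_log_weight {g : ℝ} (hg : 0 < g) :
    Antitone fun k : ℕ => ENNReal.ofReal ((1 + Real.log (k + 1 : ℕ)) ^ (-g)) := fun i j hij =>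
  ENNReal.ofReal_le_ofReal (Real.rpow_le_rpow_of_nonpos
    (add_pos_of_pos_of_nonneg one_pos (Real.log_natCast_nonneg _)) (by gcongr) (neg_nonpos.2 hg.le))

theorem tsum_log_weight_mul_ramp_sub_le {g N u : ℝ} (hg : 0 < g) (hN : 1 ≤ N) (hu0 : 0 < u)
    (hu1 : u ≤ 1) :
    ∑' k : ℕ, ENNReal.ofReal ((1 + Real.log (k + 1 : ℕ)) ^ (-g)) *
        ENNReal.ofReal (ramp (N * (k + 1 : ℕ) * u) - ramp (N * k * u)) ≤
      ENNReal.ofReal (2 * (2 * (1 + 2 * g)) ^ g * (1 + Real.log N) ^ g) *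
        ENNReal.ofReal ((1 + |Real.log u|) ^ (-g)) := by
  set x : ℕ → ℝ := fun k => ramp (N * k * u)
  set A := (2 * (1 + 2 * g)) ^ g * (1 + Real.log N) ^ g * (1 + |Real.log u|) ^ (-g) with hA
  have hlogN : 0 ≤ Real.log N := Real.log_nonneg hN
  have : 0 ≤ A := by positivity
  have hmono : Monotone x := fun i j hij => ramp_mono (by gcongr)
  have hterm (k : ℕ) : (1 + Real.log (k + 1 : ℕ)) ^ (-g) * (x (k + 1) - x k) ≤
      A * ((√(x (k + 1)))⁻¹ * (x (k + 1) - x k)) := by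
    rw [← mul_assoc]
    exact mul_le_mul_of_nonneg_right
      (one_add_log_rpow_neg_le hg hN (by exact_mod_cast k.succ_pos) hu0 hu1)
      (sub_nonneg.2 (hmono k.le_succ))
  have hnonneg (k : ℕ) : 0 ≤ (1 + Real.log (k + 1 : ℕ)) ^ (-g) :=
    Real.rpow_nonneg (add_nonneg zero_le_one (Real.log_natCast_nonneg _)) _
  have hsum (n : ℕ) : ∑ k ∈ Finset.range n,
      (1 + Real.log (k + 1 : ℕ)) ^ (-g) * (x (k + 1) - x k) ≤ 2 * A :=
    calc _ ≤ A * ∑ k ∈ Finset.range n, (√(x (k + 1)))⁻¹ * (x (k + 1) - x k) := by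
          rw [Finset.mul_sum]
          exact Finset.sum_le_sum fun k _ => hterm k
      _ ≤ A * (2 * √(x n)) := by
          gcongr
          exact sum_range_inv_sqrt_mul_sub_le hmono (ramp_nonneg _) n
      _ ≤ A * (2 * 1) := by
          gcongr
          exact Real.sqrt_le_one.2 (ramp_le_one _)
      _ = 2 * A := by ring
  refine ENNReal.tsum_le_of_sum_range_le fun n => ?_
  simp_rw [← ENNReal.ofReal_mul (hnonneg _)]
  rw [← ENNReal.ofReal_sum_of_nonneg fun k _ =>
      mul_nonneg (hnonneg k) (sub_nonneg.2 (hmono k.le_succ)),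
    ← ENNReal.ofReal_mul (by positivity)]
  exact ENNReal.ofReal_le_ofReal ((hsum n).trans_eq (by rw [hA]; ring))

end LogWeights

section Rearrangement

theorem rearrangement_antitone (f : ℝ → ℂ) : Antitone (rearrangement f) := fun _ _ h =>
  sInf_le_sInf fun _ hs => le_trans hs (ENNReal.ofReal_le_ofReal h)

theorem measurable_rearrangement (f : ℝ → ℂ) : Measurable (rearrangement f) :=
  (rearrangement_antitone f).measurable

theorem lt_rearrangement_iff (f : ℝ → ℂ) (t : ℝ) (s : ℝ≥0∞) :
    s < rearrangement f t ↔ ENNReal.ofReal t < unitMeasure {x | s < ‖f x‖ₑ} := by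
  constructor
  · intro h
    by_contra! hc
    exact absurd (sInf_le (a := s) hc) (not_le.2 h)
  · intro h
    have hs : s < ⊤ := by
      by_contra! htop
      rw [top_le_iff.1 htop] at h
      simp at h
    obtain ⟨u, hu, hus, hlim⟩ := exists_seq_strictAnti_tendsto' hs
    have hunion : {x | s < ‖f x‖ₑ} = ⋃ n, {x | u n < ‖f x‖ₑ} := by
      ext x
      simp only [mem_iUnion]
      constructor
      · intro hx
        exact (hlim.eventually_lt_const hx).exists
      · rintro ⟨n, hn⟩
        exact (hus n).1.trans hn
    have hmono : Monotone fun n => {x | u n < ‖f x‖ₑ} := fun m n hmn x hx =>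
      (hu.antitone hmn).trans_lt hx
    rw [hunion, hmono.measure_iUnion] at h
    obtain ⟨n, hn⟩ := lt_iSup_iff.1 h
    refine (hus n).1.trans_le (le_sInf fun r hr => ?_)
    by_contra! hrn
    exact absurd (hn.trans_le (measure_mono fun x hx => hrn.trans hx)) (not_lt.2 hr)

instance isProbabilityMeasure_unitMeasure : IsProbabilityMeasure unitMeasure := ⟨by simp⟩

theorem volume_Ioo_inter_lt_ofReal {d : ℝ≥0∞} (hd : d ≤ 1) :
    volume ({u : ℝ | ENNReal.ofReal u < d} ∩ Ioo 0 1) = d := by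
  lift d to NNReal using ne_top_of_le_ne_top ENNReal.one_ne_top hd
  have hd' : (d : ℝ) ≤ 1 := by exact_mod_cast hd
  have hinter : {u : ℝ | ENNReal.ofReal u < d} ∩ Ioo 0 1 = Ioo 0 (d : ℝ) := by
    ext u
    have hlt (h0 : 0 < u) : ENNReal.ofReal u < d ↔ u < d := by
      rw [← ENNReal.ofReal_coe_nnreal, ENNReal.ofReal_lt_ofReal_iff_of_nonneg h0.le]
    exact ⟨fun h => ⟨h.2.1, (hlt h.2.1).1 h.1⟩,
      fun h => ⟨(hlt h.1).2 h.2, h.1, h.2.trans_le hd'⟩⟩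
  rw [hinter, Real.volume_Ioo, sub_zero, ENNReal.ofReal_coe_nnreal]

theorem map_enorm_eq_map_rearrangement {f : ℝ → ℂ} (hf : AEStronglyMeasurable f unitMeasure) :
    unitMeasure.map (fun x => ‖f x‖ₑ) =
      (volume.restrict (Ioo (0 : ℝ) 1)).map (rearrangement f) := by
  have hfm : AEMeasurable (fun x => ‖f x‖ₑ) unitMeasure := hf.enorm
  have : IsFiniteMeasure (unitMeasure.map fun x => ‖f x‖ₑ) := inferInstance
  refine ext_of_generate_finite (range Ioi) ?_ isPiSystem_Ioi ?_ ?_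
  · rw [← borel_eq_generateFrom_Ioi]
    exact BorelSpace.measurable_eq
  · rintro _ ⟨s, rfl⟩
    rw [Measure.map_apply_of_aemeasurable hfm measurableSet_Ioi,
      Measure.map_apply (measurable_rearrangement f) measurableSet_Ioi,
      Measure.restrict_apply (measurable_rearrangement f measurableSet_Ioi)]
    have hpreimage : rearrangement f ⁻¹' Ioi s =
        {u : ℝ | ENNReal.ofReal u < unitMeasure {x | s < ‖f x‖ₑ}} :=
      ext fun u => lt_rearrangement_iff f u s
    rw [hpreimage, volume_Ioo_inter_lt_ofReal prob_le_one]
    rfl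
  · rw [Measure.map_apply_of_aemeasurable hfm .univ,
      Measure.map_apply (measurable_rearrangement f) .univ]
    simp

theorem lintegral_comp_enorm_eq_rearrangement {f : ℝ → ℂ}
    (hf : AEStronglyMeasurable f unitMeasure) {g : ℝ≥0∞ → ℝ≥0∞} (hg : Measurable g) :
    ∫⁻ x, g ‖f x‖ₑ ∂unitMeasure = ∫⁻ u in Ioo (0 : ℝ) 1, g (rearrangement f u) := by
  rw [← lintegral_map' (f := g) hg.aemeasurable hf.enorm, map_enorm_eq_map_rearrangement hf,
    lintegral_map hg (measurable_rearrangement f)]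

theorem lintegral_enorm_indicator_gt_le {f : ℝ → ℂ} (hf : AEStronglyMeasurable f unitMeasure)
    {t : ℝ} (ht : t ≤ 1) :
    ∫⁻ x, ‖{x | rearrangement f t < ‖f x‖ₑ}.indicator f x‖ₑ ∂unitMeasure ≤
      ∫⁻ u in Ioo (0 : ℝ) t, rearrangement f u := by
  have hcut (x : ℝ) : ‖{x | rearrangement f t < ‖f x‖ₑ}.indicator f x‖ₑ =
      (Ioi (rearrangement f t)).indicator id ‖f x‖ₑ := by
    by_cases hx : rearrangement f t < ‖f x‖ₑ <;> simp [indicator, hx]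
  simp_rw [hcut]
  calc _ = ∫⁻ u in Ioo (0 : ℝ) 1, (Ioi (rearrangement f t)).indicator id (rearrangement f u) :=
        lintegral_comp_enorm_eq_rearrangement hf (measurable_id.indicator measurableSet_Ioi)
    _ ≤ ∫⁻ u in Ioo (0 : ℝ) 1, (Ioo 0 t).indicator (rearrangement f) u := by
        refine setLIntegral_mono ((measurable_rearrangement f).indicator measurableSet_Ioo)
          fun u hu => ?_
        obtain hut | htu := lt_or_ge u t
        · rw [indicator_of_mem (s := Ioo 0 t) ⟨hu.1, hut⟩]
          exact indicator_le_self _ _ _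
        · rw [indicator_of_notMem (notMem_Ioi.2 (rearrangement_antitone f htu))]
          exact zero_le
    _ = _ := by
        rw [lintegral_indicator measurableSet_Ioo, Measure.restrict_restrict measurableSet_Ioo,
          inter_eq_self_of_subset_left (Ioo_subset_Ioo_right ht)]

theorem lintegral_enorm_sq_indicator_compl_le {f : ℝ → ℂ}
    (hf : AEStronglyMeasurable f unitMeasure) {t : ℝ} (ht0 : 0 < t) (ht1 : t ≤ 1) :
    ∫⁻ x, ‖{x | rearrangement f t < ‖f x‖ₑ}ᶜ.indicator f x‖ₑ ^ 2 ∂unitMeasure ≤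
      ENNReal.ofReal t * rearrangement f t ^ 2 +
        ∫⁻ u in Ico t 1, rearrangement f u ^ 2 := by
  have hcut (x : ℝ) : ‖{x | rearrangement f t < ‖f x‖ₑ}ᶜ.indicator f x‖ₑ ^ 2 =
      (Iic (rearrangement f t)).indicator (· ^ 2) ‖f x‖ₑ := by
    obtain hx | hx := lt_or_ge (rearrangement f t) ‖f x‖ₑ
    · simp [indicator, hx]
    · simp [indicator, hx, hx.not_gt]
  simp_rw [hcut]
  calc _ = ∫⁻ u in Ioo 0 t ∪ Ico t 1,
          (Iic (rearrangement f t)).indicator (· ^ 2) (rearrangement f u) := by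
        rw [Ioo_union_Ico_eq_Ioo ht0 ht1]
        exact lintegral_comp_enorm_eq_rearrangement hf
          ((measurable_id.pow_const 2).indicator measurableSet_Iic)
    _ ≤ _ := lintegral_union_le _ _ _
    _ ≤ (∫⁻ _ in Ioo 0 t, rearrangement f t ^ 2) + ∫⁻ u in Ico t 1, rearrangement f u ^ 2 := by
        refine add_le_add (lintegral_mono fun u => ?_)
          (lintegral_mono fun u => indicator_le_self _ _ _)
        exact indicator_apply_le' (fun hu => pow_le_pow_left' hu 2) fun _ => zero_le
    _ = _ := by simp [mul_comm]

end Rearrangement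

section DampedEnergy

theorem sq_lintegral_le_lintegral_inv_mul {X : Type*} [MeasurableSpace X] {μ : Measure X}
    {w g : X → ℝ≥0∞} (hw : AEMeasurable w μ) (hg : AEMeasurable g μ)
    (hw0 : ∀ᵐ x ∂μ, w x ≠ 0) (hwt : ∀ᵐ x ∂μ, w x ≠ ⊤) :
    (∫⁻ x, g x ∂μ) ^ 2 ≤ (∫⁻ x, (w x)⁻¹ ∂μ) * ∫⁻ x, w x * g x ^ 2 ∂μ := by
  have hfactor : ∫⁻ x, g x ∂μ =
      ∫⁻ x, (w x)⁻¹ ^ (1 / 2 : ℝ) * (w x * g x ^ 2) ^ (1 / 2 : ℝ) ∂μ := by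
    refine lintegral_congr_ae ?_
    filter_upwards [hw0, hwt] with x h0 ht
    rw [← ENNReal.mul_rpow_of_nonneg _ _ one_half_pos.le, ← mul_assoc,
      ENNReal.inv_mul_cancel h0 ht, one_mul, ← ENNReal.rpow_ofNat, ← ENNReal.rpow_mul]
    norm_num
  calc (∫⁻ x, g x ∂μ) ^ 2
      ≤ ((∫⁻ x, (w x)⁻¹ ∂μ) ^ (1 / 2 : ℝ) * (∫⁻ x, w x * g x ^ 2 ∂μ) ^ (1 / 2 : ℝ)) ^ 2 := by
        rw [hfactor]
        gcongr
        exact ENNReal.lintegral_mul_norm_pow_le hw.inv (hw.mul (hg.pow_const 2))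
          one_half_pos.le one_half_pos.le (by norm_num)
    _ = _ := by
        rw [← ENNReal.mul_rpow_of_nonneg _ _ one_half_pos.le, ← ENNReal.rpow_ofNat,
          ← ENNReal.rpow_mul]
        norm_num

theorem setLIntegral_inv_sqrt {t : ℝ} (ht : 0 ≤ t) :
    ∫⁻ u in Ioo 0 t, (ENNReal.ofReal √u)⁻¹ = ENNReal.ofReal (2 * √t) := by
  have hint : IntegrableOn (fun u : ℝ => u ^ (-(1 / 2) : ℝ)) (Ioo 0 t) :=
    (intervalIntegrable_iff_integrableOn_Ioo_of_le ht).1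
      (intervalIntegral.intervalIntegrable_rpow' (by norm_num))
  calc ∫⁻ u in Ioo 0 t, (ENNReal.ofReal √u)⁻¹
      = ∫⁻ u in Ioo 0 t, ENNReal.ofReal (u ^ (-(1 / 2) : ℝ)) :=
        setLIntegral_congr_fun measurableSet_Ioo fun u hu => by
          rw [← ENNReal.ofReal_inv_of_pos (Real.sqrt_pos.2 hu.1), Real.sqrt_eq_rpow,
            Real.rpow_neg hu.1.le]
    _ = ENNReal.ofReal (∫ u in Ioo 0 t, u ^ (-(1 / 2) : ℝ)) :=
        (ofReal_integral_eq_lintegral_ofReal hint (ae_restrict_of_forall_mem measurableSet_Ioo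
          fun u hu => Real.rpow_nonneg hu.1.le _)).symm
    _ = ENNReal.ofReal (2 * √t) := by
        rw [← integral_Ioc_eq_integral_Ioo, ← intervalIntegral.integral_of_le ht,
          integral_rpow (Or.inl (by norm_num)), Real.sqrt_eq_rpow]
        congr 1
        norm_num
        ring

/-- The energy of `f` with its part above the level `f^*(1 / τ)` damped: up to constants, both the
energy of `f` below that level and `τ` times the squared `L_1` norm of `f` above it are at most
`dampedEnergy f τ`. -/
noncomputable def dampedEnergy (f : ℝ → ℂ) (τ : ℝ) : ℝ≥0∞ :=
  ∫⁻ u in Ioo (0 : ℝ) 1, ENNReal.ofReal (ramp (τ * u)) * rearrangement f u ^ 2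

theorem setLIntegral_rearrangement_sq_le (f : ℝ → ℂ) {t : ℝ} (ht : 0 < t) :
    ∫⁻ u in Ico t 1, rearrangement f u ^ 2 ≤ dampedEnergy f t⁻¹ :=
  calc ∫⁻ u in Ico t 1, rearrangement f u ^ 2
      = ∫⁻ u in Ico t 1, ENNReal.ofReal (ramp (t⁻¹ * u)) * rearrangement f u ^ 2 :=
        setLIntegral_congr_fun measurableSet_Ico fun u hu => by
          simp [ramp_eq_one ((one_le_inv_mul₀ ht).2 hu.1)]
    _ ≤ dampedEnergy f t⁻¹ := lintegral_mono_set fun _ hu => ⟨ht.trans_le hu.1, hu.2⟩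

theorem sq_setLIntegral_rearrangement_le (f : ℝ → ℂ) {t : ℝ} (ht : 0 < t) (ht1 : t ≤ 1) :
    (∫⁻ u in Ioo 0 t, rearrangement f u) ^ 2 ≤ ENNReal.ofReal t * (2 * dampedEnergy f t⁻¹) := by
  have hpos : ∀ᵐ u ∂volume.restrict (Ioo 0 t), ENNReal.ofReal √u ≠ 0 :=
    ae_restrict_of_forall_mem measurableSet_Ioo fun u hu =>
      (ENNReal.ofReal_pos.2 (Real.sqrt_pos.2 hu.1)).ne'
  have hdamped : ∫⁻ u in Ioo 0 t, ENNReal.ofReal √u * rearrangement f u ^ 2 ≤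
      ENNReal.ofReal √t * dampedEnergy f t⁻¹ :=
    calc _ = ∫⁻ u in Ioo 0 t, ENNReal.ofReal √t *
          (ENNReal.ofReal (ramp (t⁻¹ * u)) * rearrangement f u ^ 2) :=
          setLIntegral_congr_fun measurableSet_Ioo fun u hu => by
            rw [ramp_eq_sqrt ((inv_mul_le_one₀ ht).2 hu.2.le), ← mul_assoc,
              ← ENNReal.ofReal_mul (Real.sqrt_nonneg t), ← Real.sqrt_mul ht.le,
              mul_inv_cancel_left₀ ht.ne']
      _ = ENNReal.ofReal √t * ∫⁻ u in Ioo 0 t,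
            ENNReal.ofReal (ramp (t⁻¹ * u)) * rearrangement f u ^ 2 :=
          lintegral_const_mul' _ _ ENNReal.ofReal_ne_top
      _ ≤ _ := mul_le_mul_right (lintegral_mono_set (Ioo_subset_Ioo_right ht1)) _
  calc _ ≤ _ := sq_lintegral_le_lintegral_inv_mul (by fun_prop)
          (measurable_rearrangement f).aemeasurable hpos (.of_forall fun _ => ENNReal.ofReal_ne_top)
    _ ≤ ENNReal.ofReal (2 * √t) * (ENNReal.ofReal √t * dampedEnergy f t⁻¹) := by
        rw [setLIntegral_inv_sqrt ht.le]
        gcongr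
    _ = _ := by
        rw [← mul_assoc, ← ENNReal.ofReal_mul (by positivity), mul_assoc, Real.mul_self_sqrt ht.le,
          mul_comm 2, ENNReal.ofReal_mul ht.le, ENNReal.ofReal_ofNat, mul_assoc]

theorem ofReal_mul_rearrangement_sq_le (f : ℝ → ℂ) {t : ℝ} (ht : 0 < t) (ht1 : t ≤ 1) :
    ENNReal.ofReal t * rearrangement f t ^ 2 ≤ 2 * dampedEnergy f t⁻¹ := by
  have hmean : ENNReal.ofReal t * rearrangement f t ≤ ∫⁻ u in Ioo 0 t, rearrangement f u :=
    calc _ = ∫⁻ _ in Ioo 0 t, rearrangement f t := by simp [mul_comm]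
      _ ≤ _ := setLIntegral_mono (measurable_rearrangement f)
        fun u hu => rearrangement_antitone f hu.2.le
  refine (ENNReal.mul_le_mul_iff_right (ENNReal.ofReal_pos.2 ht).ne' ENNReal.ofReal_ne_top).1 ?_
  calc _ = (ENNReal.ofReal t * rearrangement f t) ^ 2 := by ring
    _ ≤ (∫⁻ u in Ioo 0 t, rearrangement f u) ^ 2 := pow_le_pow_left' hmean 2
    _ ≤ _ := sq_setLIntegral_rearrangement_le f ht ht1

theorem lintegral_enorm_sq_indicator_compl_le_dampedEnergy {f : ℝ → ℂ}
    (hf : AEStronglyMeasurable f unitMeasure) {t : ℝ} (ht : 0 < t) (ht1 : t ≤ 1) :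
    ∫⁻ x, ‖{x | rearrangement f t < ‖f x‖ₑ}ᶜ.indicator f x‖ₑ ^ 2 ∂unitMeasure ≤
      3 * dampedEnergy f t⁻¹ := by
  calc _ ≤ _ := lintegral_enorm_sq_indicator_compl_le hf ht ht1
    _ ≤ 2 * dampedEnergy f t⁻¹ + dampedEnergy f t⁻¹ :=
      add_le_add (ofReal_mul_rearrangement_sq_le f ht ht1) (setLIntegral_rearrangement_sq_le f ht)
    _ = _ := by ring

theorem sum_range_lintegral_ramp_sub (f : ℝ → ℂ) {N : ℝ} (hN : 0 ≤ N) (n : ℕ) :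
    ∑ k ∈ Finset.range n, ∫⁻ u in Ioo (0 : ℝ) 1,
        ENNReal.ofReal (ramp (N * (k + 1 : ℕ) * u) - ramp (N * k * u)) * rearrangement f u ^ 2 =
      dampedEnergy f (N * n) := by
  have hmeas := measurable_rearrangement f
  have hramp := measurable_ramp
  rw [← lintegral_finsetSum _ fun k _ => by fun_prop]
  refine setLIntegral_congr_fun measurableSet_Ioo fun u hu => ?_
  have hmono : Monotone fun k : ℕ => ramp (N * k * u) := fun i j hij =>
    ramp_mono (by have := hu.1.le; gcongr)
  rw [← Finset.sum_mul, ← ENNReal.ofReal_sum_of_nonneg fun k _ => sub_nonneg.2 (hmono k.le_succ),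
    Finset.sum_range_sub fun k : ℕ => ramp (N * k * u)]
  simp [ramp_zero]

theorem tsum_log_weight_mul_lintegral_ramp_sub_le {g N : ℝ} (hg : 0 < g) (hN : 1 ≤ N)
    (f : ℝ → ℂ) :
    ∑' k : ℕ, ENNReal.ofReal ((1 + Real.log (k + 1 : ℕ)) ^ (-g)) * ∫⁻ u in Ioo (0 : ℝ) 1,
        ENNReal.ofReal (ramp (N * (k + 1 : ℕ) * u) - ramp (N * k * u)) * rearrangement f u ^ 2 ≤
      ENNReal.ofReal (2 * (2 * (1 + 2 * g)) ^ g * (1 + Real.log N) ^ g) *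
        ∫⁻ u in Ioo (0 : ℝ) 1,
          ENNReal.ofReal ((1 + |Real.log u|) ^ (-g)) * rearrangement f u ^ 2 := by
  have hmeas := measurable_rearrangement f
  have hramp := measurable_ramp
  simp_rw [← lintegral_const_mul' _ _ ENNReal.ofReal_ne_top, ← mul_assoc]
  rw [← lintegral_tsum fun k => by fun_prop]
  refine setLIntegral_mono (by fun_prop) fun u hu => ?_
  rw [ENNReal.tsum_mul_right]
  gcongr
  exact tsum_log_weight_mul_ramp_sub_le hg hN hu.1 hu.2.le

theorem dampedEnergy_one_le {g : ℝ} (hg : 0 < g) (f : ℝ → ℂ) :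
    dampedEnergy f 1 ≤ ENNReal.ofReal (2 * (2 * (1 + 2 * g)) ^ g) *
        ∫⁻ u in Ioo (0 : ℝ) 1,
          ENNReal.ofReal ((1 + |Real.log u|) ^ (-g)) * rearrangement f u ^ 2 := by
  have h := (ENNReal.le_tsum 0).trans (tsum_log_weight_mul_lintegral_ramp_sub_le hg le_rfl f)
  simpa [ramp_zero, dampedEnergy] using h

theorem integrable_of_dampedEnergy_one_ne_top {f : ℝ → ℂ}
    (hf : AEStronglyMeasurable f unitMeasure) (hE : dampedEnergy f 1 ≠ ⊤) :
    Integrable f unitMeasure := by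
  refine ⟨hf, ?_⟩
  have hsq := sq_setLIntegral_rearrangement_le f one_pos le_rfl
  have hid : ∫⁻ x, ‖f x‖ₑ ∂unitMeasure = ∫⁻ u in Ioo 0 1, rearrangement f u :=
    lintegral_comp_enorm_eq_rearrangement hf measurable_id
  rw [← hid, inv_one] at hsq
  have hlt := hsq.trans_lt
    (ENNReal.mul_lt_top ENNReal.ofReal_lt_top (ENNReal.mul_lt_top ENNReal.ofNat_lt_top hE.lt_top))
  exact (ENNReal.pow_lt_top_iff.1 hlt).resolve_right two_ne_zero

end DampedEnergy

section Sequence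

variable {ι κ : Type*}

theorem tsum_eq_lintegral_encard (a : ι → ℝ≥0∞) :
    ∑' i, a i = ∫⁻ t in Ioi (0 : ℝ), ({i | ENNReal.ofReal t < a i}.encard : ℝ≥0∞) := by
  by_cases htop : ∃ i, a i = ⊤
  · obtain ⟨i, hi⟩ := htop
    rw [ENNReal.tsum_eq_top_of_eq_top ⟨i, hi⟩, eq_comm, ← top_le_iff]
    calc ⊤ = ∫⁻ _ in Ioi (0 : ℝ), 1 := by simp
      _ ≤ _ := lintegral_mono fun t => by
        have hmem : i ∈ {i | ENNReal.ofReal t < a i} := by simp [hi]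
        simpa using (ENat.toENNReal_le.2 (one_le_encard_iff_nonempty.2 ⟨i, hmem⟩))
  push Not at htop
  let _ : MeasurableSpace ι := ⊤
  have : DiscreteMeasurableSpace ι := ⟨fun _ => trivial⟩
  have hlayer := lintegral_eq_lintegral_meas_lt (Measure.count : Measure ι)
    (f := fun i => (a i).toReal) (.of_forall fun i => ENNReal.toReal_nonneg)
    Measurable.of_discrete.aemeasurable
  simp_rw [ENNReal.ofReal_toReal (htop _)] at hlayer
  rw [lintegral_count] at hlayer
  rw [hlayer]
  refine setLIntegral_congr_fun measurableSet_Ioi fun t ht => ?_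
  simp_rw [Measure.count_apply MeasurableSet.of_discrete,
    ENNReal.ofReal_lt_iff_lt_toReal (mem_Ioi.1 ht).le (htop _)]

theorem tsum_le_tsum_of_encard_le {a : ι → ℝ≥0∞} {b : κ → ℝ≥0∞}
    (h : ∀ s, {i | s < a i}.encard ≤ {j | s < b j}.encard) : ∑' i, a i ≤ ∑' j, b j := by
  rw [tsum_eq_lintegral_encard, tsum_eq_lintegral_encard]
  exact lintegral_mono fun t => ENat.toENNReal_le.2 (h _)

theorem encard_lt_seqRearrangement_le (c : ι → ℂ) (s : ℝ≥0∞) :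
    {j : ℕ | s < seqRearrangement c (j + 1)}.encard ≤ {n | s < ‖c n‖ₑ}.encard := by
  have hsub : ∀ j ∈ {j : ℕ | s < seqRearrangement c (j + 1)},
      ((j + 1 : ℕ) : ℕ∞) ≤ {n | s < ‖c n‖ₑ}.encard := fun j hj => by
    by_contra! hlt
    exact (sInf_le (a := s) hlt).not_gt hj
  generalize {n | s < ‖c n‖ₑ}.encard = E at hsub ⊢
  induction E using ENat.recTopCoe with
  | top => exact le_top
  | coe e =>
    have hrange : {j : ℕ | s < seqRearrangement c (j + 1)} ⊆ (Finset.range e : Finset ℕ) :=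
      fun j hj => Finset.mem_coe.2 (Finset.mem_range.2 (Nat.cast_le.1 (hsub j hj)))
    exact (encard_le_encard hrange).trans_eq (by
      rw [encard_coe_eq_coe_finsetCard, Finset.card_range])

theorem tsum_seqRearrangement_sq_le (c : ι → ℂ) :
    ∑' j : ℕ, seqRearrangement c (j + 1) ^ 2 ≤ ∑' n, ‖c n‖ₑ ^ 2 := by
  refine tsum_le_tsum_of_encard_le fun s => ?_
  obtain ⟨r, rfl⟩ : ∃ r : ℝ≥0∞, r ^ 2 = s :=
    ⟨s ^ (1 / 2 : ℝ), by rw [← ENNReal.rpow_ofNat, ← ENNReal.rpow_mul]; norm_num⟩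
  simp_rw [(ENNReal.pow_right_strictMono two_ne_zero).lt_iff_lt]
  exact encard_lt_seqRearrangement_le c r

theorem seqRearrangement_add_le (a : ι → ℂ) {b : ι → ℂ} {D : ℝ≥0∞} (hb : ∀ n, ‖b n‖ₑ ≤ D)
    (k : ℕ) : seqRearrangement (a + b) k ≤ seqRearrangement a k + D := by
  rw [seqRearrangement, seqRearrangement, ENNReal.sInf_add]
  refine le_iInf₂ fun s hs => sInf_le ((encard_le_encard fun n hn => ?_).trans_lt hs)
  rw [mem_ofPred_eq] at hn ⊢
  by_contra! hle
  exact hn.not_ge ((enorm_add_le _ _).trans (add_le_add hle (hb n)))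

theorem sum_range_seqRearrangement_add_sq_le (a : ι → ℂ) {b : ι → ℂ} {D : ℝ≥0∞}
    (hb : ∀ n, ‖b n‖ₑ ≤ D) (j : ℕ) :
    ∑ k ∈ Finset.range j, seqRearrangement (a + b) (k + 1) ^ 2 ≤
      2 * (∑' n, ‖a n‖ₑ ^ 2 + j * D ^ 2) := by
  have add_sq_le (x y : ℝ≥0∞) : (x + y) ^ 2 ≤ 2 * (x ^ 2 + y ^ 2) := by
    simpa [show (2 : ℝ) - 1 = 1 by norm_num, ← mul_add] using
      ENNReal.rpow_add_le_mul_rpow_add_rpow x y one_le_two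
  calc _ ≤ ∑ k ∈ Finset.range j, 2 * (seqRearrangement a (k + 1) ^ 2 + D ^ 2) :=
        Finset.sum_le_sum fun k _ =>
          (pow_le_pow_left' (seqRearrangement_add_le a hb (k + 1)) 2).trans (add_sq_le _ _)
    _ = 2 * (∑ k ∈ Finset.range j, seqRearrangement a (k + 1) ^ 2 + j * D ^ 2) := by
        rw [← Finset.mul_sum, Finset.sum_add_distrib, Finset.sum_const, Finset.card_range,
          nsmul_eq_mul]
    _ ≤ _ := by
        gcongr
        exact (ENNReal.sum_le_tsum _).trans (tsum_seqRearrangement_sq_le a)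

end Sequence

section Fourier

variable {ι : Type*} {φ : ι → Lp ℂ 2 unitMeasure}

theorem integrable_mul_conj {X : Type*} [MeasurableSpace X] {μ : Measure X} {f ψ : X → ℂ}
    (hf : Integrable f μ) (hψ : MemLp ψ ∞ μ) : Integrable (fun x => f x * conj (ψ x)) μ :=
  hf.mul_of_top_left hψ.star

theorem fourierMap_add (hφ : ∀ n, MemLp (φ n) ∞ unitMeasure) {f g : ℝ → ℂ}
    (hf : Integrable f unitMeasure) (hg : Integrable g unitMeasure) :
    fourierMap φ (f + g) = fourierMap φ f + fourierMap φ g := by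
  ext n
  simp only [fourierMap, Pi.add_apply, add_mul]
  exact integral_add (integrable_mul_conj hf (hφ n)) (integrable_mul_conj hg (hφ n))

theorem enorm_fourierMap_le {n : ι} (hn : eLpNorm (φ n) ∞ unitMeasure ≠ ⊤) (f : ℝ → ℂ) :
    ‖fourierMap φ f n‖ₑ ≤ eLpNorm (φ n) ∞ unitMeasure * ∫⁻ x, ‖f x‖ₑ ∂unitMeasure :=
  calc _ ≤ ∫⁻ x, ‖f x * conj (φ n x)‖ₑ ∂unitMeasure := enorm_integral_le_lintegral_enorm _
    _ ≤ ∫⁻ x, eLpNorm (φ n) ∞ unitMeasure * ‖f x‖ₑ ∂unitMeasure := by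
        refine lintegral_mono_ae ?_
        rw [eLpNorm_exponent_top]
        filter_upwards [enorm_ae_le_eLpNormEssSup (φ n) unitMeasure] with x hx
        rw [enorm_mul, RCLike.enorm_conj, mul_comm]
        gcongr
    _ = _ := lintegral_const_mul' _ _ hn

theorem tsum_enorm_fourierMap_sq_le (hφ : Orthonormal ℂ φ) {f : ℝ → ℂ}
    (hf : AEStronglyMeasurable f unitMeasure) :
    ∑' n, ‖fourierMap φ f n‖ₑ ^ 2 ≤ ∫⁻ x, ‖f x‖ₑ ^ 2 ∂unitMeasure := by
  have hnorm : eLpNorm f 2 unitMeasure ^ 2 = ∫⁻ x, ‖f x‖ₑ ^ 2 ∂unitMeasure := by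
    simpa using eLpNorm_nnreal_pow_eq_lintegral (f := f) (μ := unitMeasure) (p := 2) two_ne_zero
  obtain htop | hfin := eq_or_ne (eLpNorm f 2 unitMeasure) ⊤
  · simp [← hnorm, htop]
  have hmem : MemLp f 2 unitMeasure := ⟨hf, hfin.lt_top⟩
  have hcoef (n : ι) : fourierMap φ f n = inner ℂ (φ n) (hmem.toLp f) := by
    rw [L2.inner_def, fourierMap]
    refine integral_congr_ae (hmem.coeFn_toLp.mono fun x hx => ?_)
    simp only [RCLike.inner_apply, hx]
  calc ∑' n, ‖fourierMap φ f n‖ₑ ^ 2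
      = ∑' n, ENNReal.ofReal (‖inner ℂ (φ n) (hmem.toLp f)‖ ^ 2) :=
        tsum_congr fun n => by rw [hcoef, ENNReal.ofReal_pow (norm_nonneg _), ofReal_norm]
    _ = ENNReal.ofReal (∑' n, ‖inner ℂ (φ n) (hmem.toLp f)‖ ^ 2) :=
        (ENNReal.ofReal_tsum_of_nonneg (fun n => sq_nonneg _)
          (hφ.inner_products_summable _)).symm
    _ ≤ ENNReal.ofReal (‖hmem.toLp f‖ ^ 2) :=
        ENNReal.ofReal_le_ofReal (hφ.tsum_inner_products_le _)
    _ = _ := by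
        rw [ENNReal.ofReal_pow (norm_nonneg _), Lp.norm_toLp, ENNReal.ofReal_toReal hfin, hnorm]

theorem sum_range_seqRearrangement_fourierMap_add_sq_le (hφ : Orthonormal ℂ φ) {M : ℝ}
    (hM : ∀ n, eLpNorm (φ n) ∞ unitMeasure ≤ ENNReal.ofReal M) {f g : ℝ → ℂ}
    (hf : Integrable f unitMeasure) (hg : Integrable g unitMeasure) (j : ℕ) :
    ∑ k ∈ Finset.range j, seqRearrangement (fourierMap φ (f + g)) (k + 1) ^ 2 ≤
      2 * (∫⁻ x, ‖f x‖ₑ ^ 2 ∂unitMeasure +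
        j * (ENNReal.ofReal M * ∫⁻ x, ‖g x‖ₑ ∂unitMeasure) ^ 2) := by
  have hφ_top (n : ι) : MemLp (φ n) ∞ unitMeasure :=
    ⟨Lp.aestronglyMeasurable _, (hM n).trans_lt ENNReal.ofReal_lt_top⟩
  have hbound (n : ι) : ‖fourierMap φ g n‖ₑ ≤
      ENNReal.ofReal M * ∫⁻ x, ‖g x‖ₑ ∂unitMeasure :=
    (enorm_fourierMap_le (hφ_top n).2.ne g).trans (mul_le_mul_left (hM n) _)
  rw [fourierMap_add hφ_top hf hg]
  refine (sum_range_seqRearrangement_add_sq_le _ hbound j).trans ?_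
  gcongr
  exact tsum_enorm_fourierMap_sq_le hφ hf.1

theorem sum_range_seqRearrangement_fourierMap_sq_le (hφ : Orthonormal ℂ φ) {M : ℝ} (hM1 : 1 ≤ M)
    (hM : ∀ n, eLpNorm (φ n) ∞ unitMeasure ≤ ENNReal.ofReal M) {f : ℝ → ℂ}
    (hf : Integrable f unitMeasure) (j : ℕ) :
    ∑ k ∈ Finset.range j, seqRearrangement (fourierMap φ f) (k + 1) ^ 2 ≤
      10 * dampedEnergy f (M ^ 2 * j) := by
  obtain rfl | hj := j.eq_zero_or_pos
  · simp
  have hM0 : 0 < M := one_pos.trans_le hM1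
  set t := (M ^ 2 * j)⁻¹ with ht_def
  have ht : 0 < t := by positivity
  have ht1 : t ≤ 1 := inv_le_one_of_one_le₀
    (one_le_mul_of_one_le_of_one_le (one_le_pow₀ hM1) (by exact_mod_cast hj))
  set S := {x | rearrangement f t < ‖f x‖ₑ}
  have hS : NullMeasurableSet S unitMeasure :=
    nullMeasurableSet_lt aemeasurable_const hf.1.enorm
  have hpeak : j * (ENNReal.ofReal M * ∫⁻ x, ‖S.indicator f x‖ₑ ∂unitMeasure) ^ 2 ≤
      2 * dampedEnergy f t⁻¹ :=
    calc _ ≤ j * (ENNReal.ofReal M * ∫⁻ u in Ioo 0 t, rearrangement f u) ^ 2 := by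
          refine mul_le_mul_right (pow_le_pow_left' (mul_le_mul_right ?_ _) 2) _
          exact lintegral_enorm_indicator_gt_le hf.1 ht1
      _ = ENNReal.ofReal (M ^ 2 * j) * (∫⁻ u in Ioo 0 t, rearrangement f u) ^ 2 := by
          rw [mul_pow, ENNReal.ofReal_mul (by positivity), ENNReal.ofReal_pow hM0.le,
            ENNReal.ofReal_natCast]
          ring
      _ ≤ ENNReal.ofReal (M ^ 2 * j) * (ENNReal.ofReal t * (2 * dampedEnergy f t⁻¹)) := by
          gcongr
          exact sq_setLIntegral_rearrangement_le f ht ht1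
      _ = _ := by
          rw [← mul_assoc, ← ENNReal.ofReal_mul (by positivity), ht_def,
            mul_inv_cancel₀ (by positivity), ENNReal.ofReal_one, one_mul]
  calc ∑ k ∈ Finset.range j, seqRearrangement (fourierMap φ f) (k + 1) ^ 2
      = ∑ k ∈ Finset.range j,
          seqRearrangement (fourierMap φ (Sᶜ.indicator f + S.indicator f)) (k + 1) ^ 2 := by
        rw [indicator_compl_add_self]
    _ ≤ _ := sum_range_seqRearrangement_fourierMap_add_sq_le hφ hM (hf.indicator₀ hS.compl)
        (hf.indicator₀ hS) j
    _ ≤ 2 * (3 * dampedEnergy f t⁻¹ + 2 * dampedEnergy f t⁻¹) := by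
        gcongr
        exact lintegral_enorm_sq_indicator_compl_le_dampedEnergy hf.1 ht ht1
    _ = 10 * dampedEnergy f (M ^ 2 * j) := by rw [ht_def, inv_inv]; ring

end Fourier

section Norms

theorem eLpNorm_two_rpow_weight_mul_sq {X : Type*} [MeasurableSpace X] (μ : Measure X) (g : ℝ)
    (x : X → ℝ) {y : X → ℝ} (hy : ∀ i, 0 < y i) (a : X → ℝ≥0∞) :
    eLpNorm (fun i => ENNReal.ofReal
      (x i ^ ((2 : ℝ≥0∞).toReal⁻¹ - (2 : ℝ≥0∞).toReal⁻¹) * y i ^ (-(g / 2))) * a i) 2 μ ^ 2 =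
      ∫⁻ i, ENNReal.ofReal (y i ^ (-g)) * a i ^ 2 ∂μ := by
  have hsquare (i : X) : (y i ^ (-(g / 2))) ^ 2 = y i ^ (-g) := by
    rw [← Real.rpow_mul_natCast (hy i).le, Nat.cast_ofNat, neg_mul, div_mul_cancel₀ _ two_ne_zero]
  simp_rw [sub_self, Real.rpow_zero, one_mul]
  calc _ = ∫⁻ i, (ENNReal.ofReal (y i ^ (-(g / 2))) * a i) ^ 2 ∂μ := by
        simpa using eLpNorm_nnreal_pow_eq_lintegral (p := 2) two_ne_zero (μ := μ)
          (f := fun i => ENNReal.ofReal (y i ^ (-(g / 2))) * a i)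
    _ = _ := by
        simp_rw [mul_pow, ← ENNReal.ofReal_pow (Real.rpow_nonneg (hy _).le _), hsquare]

theorem lorentzZygmundNorm_two_two_sq (g : ℝ) (f : ℝ → ℂ) :
    lorentzZygmundNorm 2 2 (-(g / 2)) f ^ 2 = ∫⁻ u in Ioo (0 : ℝ) 1,
      ENNReal.ofReal ((1 + |Real.log u|) ^ (-g)) * rearrangement f u ^ 2 :=
  eLpNorm_two_rpow_weight_mul_sq _ g _ (fun _ => by positivity) _

theorem seqLorentzZygmundNorm_two_two_sq {ι : Type*} (g : ℝ) (c : ι → ℂ) :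
    seqLorentzZygmundNorm 2 2 (-(g / 2)) c ^ 2 = ∑' j : ℕ,
      ENNReal.ofReal ((1 + Real.log (j + 1 : ℕ)) ^ (-g)) * seqRearrangement c (j + 1) ^ 2 := by
  rw [← lintegral_count]
  exact eLpNorm_two_rpow_weight_mul_sq _ g _
    (fun _ => add_pos_of_pos_of_nonneg one_pos (Real.log_natCast_nonneg _)) _

end Norms

section Main

variable {ι : Type*} {φ : ι → Lp ℂ 2 unitMeasure} {f : ℝ → ℂ} {g M : ℝ}

theorem one_le_of_orthonormal [Nonempty ι] (hφ : Orthonormal ℂ φ)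
    (hM : ∀ n, eLpNorm (φ n) ∞ unitMeasure ≤ ENNReal.ofReal M) : 1 ≤ M := by
  obtain ⟨n⟩ := ‹Nonempty ι›
  have hnorm : eLpNorm (φ n) 2 unitMeasure = 1 :=
    (ENNReal.toReal_eq_one_iff _).1 ((Lp.norm_def _).symm.trans (hφ.1 n))
  rw [← ENNReal.one_le_ofReal, ← hnorm]
  exact (eLpNorm_le_eLpNorm_of_exponent_le le_top (Lp.aestronglyMeasurable (φ n))).trans (hM n)

theorem integrable_of_memLorentzZygmund (hg : 0 < g) (hf : MemLorentzZygmund 2 2 (-(g / 2)) f) :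
    Integrable f unitMeasure := by
  refine integrable_of_dampedEnergy_one_ne_top hf.1 (ne_top_of_le_ne_top ?_
    (dampedEnergy_one_le hg f))
  rw [← lorentzZygmundNorm_two_two_sq]
  exact ENNReal.mul_ne_top ENNReal.ofReal_ne_top (ENNReal.pow_ne_top hf.2.ne)

theorem seqLorentzZygmundNorm_fourierMap_sq_le (hg : 0 < g) (hφ : Orthonormal ℂ φ) (hM1 : 1 ≤ M)
    (hM : ∀ n, eLpNorm (φ n) ∞ unitMeasure ≤ ENNReal.ofReal M) (hf : Integrable f unitMeasure) :
    seqLorentzZygmundNorm 2 2 (-(g / 2)) (fourierMap φ f) ^ 2 ≤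
      ENNReal.ofReal (20 * (4 * (1 + 2 * g)) ^ g * (1 + Real.log M) ^ g) *
        lorentzZygmundNorm 2 2 (-(g / 2)) f ^ 2 := by
  have hlogM : 0 ≤ Real.log M := Real.log_nonneg hM1
  have hlog_sq : 1 + Real.log (M ^ 2) ≤ 2 * (1 + Real.log M) := by
    rw [Real.log_pow]; push_cast; linarith
  have hlogM2 : 0 ≤ Real.log (M ^ 2) := Real.log_nonneg (one_le_pow₀ hM1)
  have hconst : 10 * (2 * (2 * (1 + 2 * g)) ^ g * (1 + Real.log (M ^ 2)) ^ g) ≤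
      20 * (4 * (1 + 2 * g)) ^ g * (1 + Real.log M) ^ g :=
    calc _ ≤ 10 * (2 * (2 * (1 + 2 * g)) ^ g * (2 * (1 + Real.log M)) ^ g) := by gcongr
      _ = 20 * ((2 * (1 + 2 * g)) ^ g * (2 * (1 + Real.log M)) ^ g) := by ring
      _ = 20 * ((4 * (1 + 2 * g)) ^ g * (1 + Real.log M) ^ g) := by
        rw [← Real.mul_rpow (by positivity) (by positivity),
          ← Real.mul_rpow (by positivity) (by positivity)]
        ring_nf
      _ = _ := by ring
  rw [seqLorentzZygmundNorm_two_two_sq, lorentzZygmundNorm_two_two_sq]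
  calc _ ≤ ∑' k : ℕ, ENNReal.ofReal ((1 + Real.log (k + 1 : ℕ)) ^ (-g)) *
        (10 * ∫⁻ u in Ioo (0 : ℝ) 1, ENNReal.ofReal
          (ramp (M ^ 2 * (k + 1 : ℕ) * u) - ramp (M ^ 2 * k * u)) * rearrangement f u ^ 2) := by
        refine tsum_mul_le_of_sum_range_le (antitone_log_weight hg) fun n => ?_
        rw [← Finset.mul_sum, sum_range_lintegral_ramp_sub f (sq_nonneg M)]
        exact sum_range_seqRearrangement_fourierMap_sq_le hφ hM1 hM hf n
    _ = 10 * ∑' k : ℕ, ENNReal.ofReal ((1 + Real.log (k + 1 : ℕ)) ^ (-g)) *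
        ∫⁻ u in Ioo (0 : ℝ) 1, ENNReal.ofReal
          (ramp (M ^ 2 * (k + 1 : ℕ) * u) - ramp (M ^ 2 * k * u)) * rearrangement f u ^ 2 := by
        simp_rw [mul_left_comm _ (10 : ℝ≥0∞), ENNReal.tsum_mul_left]
    _ ≤ 10 * (ENNReal.ofReal (2 * (2 * (1 + 2 * g)) ^ g * (1 + Real.log (M ^ 2)) ^ g) *
        ∫⁻ u in Ioo (0 : ℝ) 1,
          ENNReal.ofReal ((1 + |Real.log u|) ^ (-g)) * rearrangement f u ^ 2) := by
        gcongr
        exact tsum_log_weight_mul_lintegral_ramp_sub_le hg (one_le_pow₀ hM1) f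
    _ ≤ _ := by
        rw [← mul_assoc, ← ENNReal.ofReal_ofNat 10, ← ENNReal.ofReal_mul (by positivity)]
        gcongr

theorem seqLorentzZygmundNorm_fourierMap_le (hg : 0 < g) (hφ : Orthonormal ℂ φ) (hM1 : 1 ≤ M)
    (hM : ∀ n, eLpNorm (φ n) ∞ unitMeasure ≤ ENNReal.ofReal M) (hf : Integrable f unitMeasure) :
    seqLorentzZygmundNorm 2 2 (-(g / 2)) (fourierMap φ f) ≤
      ENNReal.ofReal (√(20 * (4 * (1 + 2 * g)) ^ g) * (1 + Real.log M) ^ (g / 2)) *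
        lorentzZygmundNorm 2 2 (-(g / 2)) f := by
  have hlogM : 0 ≤ Real.log M := Real.log_nonneg hM1
  refine (ENNReal.pow_right_strictMono two_ne_zero).le_iff_le.1
    ((seqLorentzZygmundNorm_fourierMap_sq_le hg hφ hM1 hM hf).trans_eq ?_)
  rw [mul_pow, ← ENNReal.ofReal_pow (by positivity), mul_pow, Real.sq_sqrt (by positivity),
    ← Real.rpow_mul_natCast (by positivity), Nat.cast_ofNat, div_mul_cancel₀ _ two_ne_zero]

theorem exists_norm_fourierMap_le (hM : ∀ n, eLpNorm (φ n) ∞ unitMeasure ≤ ENNReal.ofReal M)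
    (hf : Integrable f unitMeasure) : ∃ B : ℝ, ∀ n, ‖fourierMap φ f n‖ ≤ B := by
  refine ⟨(ENNReal.ofReal M * ∫⁻ x, ‖f x‖ₑ ∂unitMeasure).toReal, fun n => ?_⟩
  rw [← toReal_enorm]
  exact ENNReal.toReal_mono (ENNReal.mul_ne_top ENNReal.ofReal_ne_top hf.2.ne)
    ((enorm_fourierMap_le (ne_top_of_le_ne_top ENNReal.ofReal_ne_top (hM n)) f).trans
      (mul_le_mul_left (hM n) _))

theorem corollary3p2_general {β b : ℝ} (hβ : β < 0) (hb : -β ≤ b) :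
    ∃ C : ℝ, 0 < C ∧
      ∀ (ι : Type*) [Nonempty ι] (φ : ι → Lp ℂ 2 unitMeasure) (M : ℝ),
        Orthonormal ℂ φ →
        (∀ n, eLpNorm (φ n) ∞ unitMeasure ≤ ENNReal.ofReal M) →
        ∀ f : ℝ → ℂ, MemLorentzZygmund 2 2 β f →
          (∀ n, Integrable (fun x => f x * conj (φ n x)) unitMeasure) ∧
          MemSeqLorentzZygmund 2 2 β (fourierMap φ f) ∧
          seqLorentzZygmundNorm 2 2 β (fourierMap φ f) ≤
            ENNReal.ofReal (C * min M ((1 + Real.log M) ^ b)) * lorentzZygmundNorm 2 2 β f := by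
  obtain ⟨g, hg, rfl⟩ : ∃ g : ℝ, 0 < g ∧ β = -(g / 2) := ⟨-(2 * β), by linarith, by ring⟩
  rw [neg_neg] at hb
  refine ⟨√(20 * (4 * (1 + 2 * g)) ^ g) * (1 + g / 2) ^ (g / 2), by positivity,
    fun ι _ φ M hφ hM f hf => ?_⟩
  have hM1 : 1 ≤ M := one_le_of_orthonormal hφ hM
  have hint : Integrable f unitMeasure := integrable_of_memLorentzZygmund hg hf
  have hle := seqLorentzZygmundNorm_fourierMap_le hg hφ hM1 hM hint
  refine ⟨fun n => integrable_mul_conj hint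
      ⟨Lp.aestronglyMeasurable _, (hM n).trans_lt ENNReal.ofReal_lt_top⟩,
    ⟨exists_norm_fourierMap_le hM hint,
      hle.trans_lt (ENNReal.mul_lt_top ENNReal.ofReal_lt_top hf.2)⟩, hle.trans ?_⟩
  rw [mul_assoc √_]
  gcongr
  exact one_add_log_rpow_le_mul_min (half_pos hg) hb hM1

end Main

theorem corollary3p2 (α : ℝ) (hα : α < -(1 / 2)) :
    ∃ C : ℝ, 0 < C ∧
      ∀ (ι : Type) [Countable ι] [Nonempty ι] (φ : ι → Lp ℂ 2 unitMeasure) (M : ℝ),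
        Orthonormal ℂ φ →
        (⨆ n, eLpNorm (φ n) ∞ unitMeasure) = ENNReal.ofReal M →
        ∀ f : ℝ → ℂ, MemLorentzZygmund 2 2 (α + 1 / 2) f →
          (∀ n, Integrable (fun x => f x * conj (φ n x)) unitMeasure) ∧
          MemSeqLorentzZygmund 2 2 (α + 1 / 2) (fourierMap φ f) ∧
          seqLorentzZygmundNorm 2 2 (α + 1 / 2) (fourierMap φ f) ≤
            ENNReal.ofReal (C * min M ((1 + Real.log M) ^ |α|)) *
              lorentzZygmundNorm 2 2 (α + 1 / 2) f := by
  obtain ⟨C, hC, h⟩ := corollary3p2_general (β := α + 1 / 2) (b := |α|) (by linarith)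
    (by rw [abs_of_neg (by linarith)]; linarith)
  exact ⟨C, hC, fun ι _ _ φ M hφ hM => h ι φ M hφ (iSup_le_iff.1 hM.le)⟩
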